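/- Call a topological space $\langle X,\tau_X\rangle$ submetrizable if there is a metrizable topology $\sigma\subseteq\tau_X$ on $X$. A perfect map is a continuous closed map with compact fibres (not necessarily onto). A space is collectionwise normal if for every discrete family $\{F_i\}_{i\in I}$ of closed sets there is a discrete family $\{V_i\}_{i\in I}$ of open sets with $F_i\subseteq V_i$ for all $i\in I$, where a family is discrete if every point has a neighbourhood meeting at most one of its members. **Theorem.** Let $\langle X,\tau_X\rangle$ and $\langle Y,\tau_Y\rangle$ be submetrizable spaces and let $f:\langle X,\tau_X\rangle\to\langle Y,\tau_Y\rangle$ be a perfect map. 1. If $Y$ is collectionwise normal and every closed subset of $Y$ is a $G_\delta$ set, then there are metrizable topologies $\sigma_X\subseteq\tau_X$ on $X$ and $\sigma_Y\subseteq\tau_Y$ on $Y$ such that $f:\langle X,\sigma_X\rangle\to\langle Y,\sigma_Y\rangle$ is perfect. 2. In particular (a positive answer to a question of Chen when $Y$ is perfectly normal), if $X$ and $Y$ are paracompact and $Y$ is perfectly normal, then such topologies $\sigma_X$ and $\sigma_Y$ exist. -/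

import Mathlib

open Topology

universe u v

/-- The metrizable topologies on `X` that are weaker (coarser) than `τ`. In Mathlib's order on
topologies, `τ ≤ σ` means that every `σ`-open set is `τ`-open. -/
def weakerMetrizable {X : Type u} (τ : TopologicalSpace X) : Set (TopologicalSpace X) :=
  {σ | τ ≤ σ ∧ @TopologicalSpace.MetrizableSpace X σ}

/-- A space is submetrizable if it has a weaker metrizable topology. -/
def Submetrizable (X : Type u) [τ : TopologicalSpace X] : Prop :=
  ∃ σ : TopologicalSpace X, σ ∈ weakerMetrizable τ

/-- An indexed family of subsets is discrete if every point has a neighbourhood that meets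
at most one member of the family. -/
def DiscreteFamily {X : Type u} [TopologicalSpace X] {ι : Type v} (F : ι → Set X) : Prop :=
  ∀ x : X, ∃ U ∈ 𝓝 x, {i : ι | (F i ∩ U).Nonempty}.Subsingleton

/-- Every discrete family of closed sets expands to a discrete family of open sets.
As with Mathlib's `NormalSpace`, the axiom T₁ is not part of this definition (every
submetrizable space is Hausdorff). The nonempty members of a discrete family are pairwise
distinct, so index types in the universe of `X` cover all cases. -/
def CollectionwiseNormal (X : Type u) [TopologicalSpace X] : Prop :=
  ∀ (ι : Type u) (F : ι → Set X), (∀ i, IsClosed (F i)) → DiscreteFamily F →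
    ∃ V : ι → Set X, (∀ i, IsOpen (V i)) ∧ (∀ i, F i ⊆ V i) ∧ DiscreteFamily V

/-- Every closed set is a `Gδ` set (this is not Mathlib's `PerfectSpace`, which means that there
are no isolated points). -/
def ClosedSetsGδ (X : Type u) [TopologicalSpace X] : Prop :=
  ∀ s : Set X, IsClosed s → IsGδ s

/-- There are weaker metrizable topologies on `X` and `Y` for which `f` is still perfect.
A perfect map is a continuous closed map with compact fibres, which is Mathlib's `IsProperMap`
(see `isProperMap_iff_isClosedMap_and_compact_fibers`). -/
def PerfectSubmetrizable {X : Type u} {Y : Type v} [τX : TopologicalSpace X]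
    [τY : TopologicalSpace Y] (f : X → Y) : Prop :=
  ∃ σX ∈ weakerMetrizable τX, ∃ σY ∈ weakerMetrizable τY, @IsProperMap X Y σX σY f

open TopologicalSpace Filter Set
open scoped BoundedContinuousFunction

universe w

/-! ### Collectionwise normal spaces -/

/-! Fix coarser metrizable `ρX`, `ρY`. Images under `f` of a locally finite closed cover of `X` by
`ρX`-small sets form a locally finite closed family in `Y`. A coarser pseudometrizable topology on
`Y` makes nearby points lie in no further members of it, so nearby fibres lie in a
`1/(n+1)`-thickening of the given one. Let `σY` be the infimum of `ρY` and these topologies over all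
`n`, and `σX` that of `ρX` and the topology induced by `f` from `σY`. If the image of an ultrafilter
converges to `y`, the ultrafilter contains every thickening of the compact fibre over `y`, hence
converges to a point of it.

The topology on `Y` comes from stratifying by the number of members through a point: the `Gδ`
hypothesis cuts each stratum into countably many closed pieces, on which the strata's members form
discrete families that collectionwise normality expands. -/

theorem DiscreteFamily.eq_of_mem {X : Type u} [TopologicalSpace X] {ι : Type v} {F : ι → Set X}
    (hF : DiscreteFamily F) {x : X} {i j : ι} (hi : x ∈ F i) (hj : x ∈ F j) : i = j := by
  obtain ⟨U, hU, h⟩ := hF x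
  exact h ⟨x, hi, mem_of_mem_nhds hU⟩ ⟨x, hj, mem_of_mem_nhds hU⟩

theorem DiscreteFamily.mono {X : Type u} [TopologicalSpace X] {ι : Type v} {F G : ι → Set X}
    (hF : DiscreteFamily F) (h : ∀ i, G i ⊆ F i) : DiscreteFamily G := fun x ↦ by
  obtain ⟨U, hU, hUF⟩ := hF x
  exact ⟨U, hU, hUF.anti fun i hi ↦ hi.mono (inter_subset_inter_left _ (h i))⟩

/-- In a collectionwise normal space, discrete families of closed sets indexed by types in any
universe expand to discrete families of open sets. -/
theorem CollectionwiseNormal.exists_open_expansion {Y : Type v} [TopologicalSpace Y]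
    (hY : CollectionwiseNormal Y) {ι : Type w} {F : ι → Set Y} (hc : ∀ i, IsClosed (F i))
    (hF : DiscreteFamily F) :
    ∃ V : ι → Set Y, (∀ i, IsOpen (V i)) ∧ (∀ i, F i ⊆ V i) ∧ DiscreteFamily V := by
  obtain ⟨V, hVo, hFV, hV⟩ := hY (range F) (fun s ↦ s) (by rintro ⟨_, i, rfl⟩; exact hc i) <| by
    intro x
    obtain ⟨U, hU, h⟩ := hF x
    refine ⟨U, hU, ?_⟩
    rintro ⟨_, i, rfl⟩ hi ⟨_, j, rfl⟩ hj
    exact Subtype.ext (congrArg F (h hi hj))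
  -- Indices with empty `F i` share one element of the range, so their expansions are made empty to
  -- keep the family discrete.
  refine ⟨fun i ↦ {y | (F i).Nonempty ∧ y ∈ V ⟨F i, i, rfl⟩}, fun i ↦ ?_,
    fun i y hy ↦ ⟨⟨y, hy⟩, hFV _ hy⟩, fun x ↦ ?_⟩
  · exact isOpen_const.and (hVo _)
  · obtain ⟨U, hU, h⟩ := hV x
    refine ⟨U, hU, ?_⟩
    rintro i ⟨y, ⟨⟨a, ha⟩, hy⟩, hyU⟩ j ⟨z, ⟨_, hz⟩, hzU⟩
    have hij : F i = F j := congrArg Subtype.val (h ⟨y, hy, hyU⟩ ⟨z, hz, hzU⟩)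
    exact hF.eq_of_mem ha (hij ▸ ha)

theorem CollectionwiseNormal.normalSpace {Y : Type v} [TopologicalSpace Y]
    (hY : CollectionwiseNormal Y) : NormalSpace Y := by
  refine ⟨fun s t hs ht hst ↦ ?_⟩
  obtain ⟨V, hVo, hFV, hV⟩ := hY.exists_open_expansion (F := fun b : Bool ↦ cond b s t)
      (by rintro (_ | _) <;> assumption) <| by
    intro x
    by_cases hx : x ∈ s
    · refine ⟨tᶜ, ht.isOpen_compl.mem_nhds (hst.notMem_of_mem_left hx), ?_⟩
      rintro (_ | _) ⟨y, hy, hy'⟩ (_ | _) ⟨z, hz, hz'⟩ <;> first | rfl | exact (hy' hy).elim |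
        exact (hz' hz).elim
    · refine ⟨sᶜ, hs.isOpen_compl.mem_nhds hx, ?_⟩
      rintro (_ | _) ⟨y, hy, hy'⟩ (_ | _) ⟨z, hz, hz'⟩ <;> first | rfl | exact (hy' hy).elim |
        exact (hz' hz).elim
  exact ⟨V true, V false, hVo _, hVo _, hFV true, hFV false,
    disjoint_left.2 fun x h₁ h₂ ↦ Bool.noConfusion (hV.eq_of_mem h₁ h₂)⟩

/-- Take a locally finite open cover whose closures each meet at most one `F i`, and remove from the
space all closures missing `F i`. The resulting open sets are pairwise disjoint; normality shrinks
them to a discrete family. -/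
theorem CollectionwiseNormal.of_paracompactSpace (Y : Type v) [TopologicalSpace Y]
    [ParacompactSpace Y] [NormalSpace Y] [T1Space Y] : CollectionwiseNormal Y := by
  intro ι F hc hF
  have hnhds (y : Y) : ∃ U ∈ 𝓝 y, IsClosed U ∧ {i | (F i ∩ U).Nonempty}.Subsingleton := by
    obtain ⟨U, hU, h⟩ := hF y
    obtain ⟨C, ⟨hC, hCc⟩, hCU⟩ := (closed_nhds_basis y).mem_iff.1 hU
    exact ⟨C, hC, hCc, h.anti fun i hi ↦ hi.mono (inter_subset_inter_right _ hCU)⟩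
  choose U hU hUc hUF using hnhds
  obtain ⟨w, -, hwU, hw, hwsub⟩ := precise_refinement (fun y ↦ interior (U y))
    (fun _ ↦ isOpen_interior)
    (iUnion_eq_univ_iff.2 fun y ↦ ⟨y, mem_interior_iff_mem_nhds.2 (hU y)⟩)
  have hCF (y : Y) : {i | (F i ∩ closure (w y)).Nonempty}.Subsingleton :=
    (hUF y).anti fun i hi ↦ hi.mono <| inter_subset_inter_right _ <|
      closure_minimal ((hwsub y).trans interior_subset) (hUc y)
  let C (i : ι) (y : Y) : Set Y := {x | x ∈ closure (w y) ∧ Disjoint (F i) (closure (w y))}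
  let V (i : ι) : Set Y := (⋃ y, C i y)ᶜ
  have hVo (i : ι) : IsOpen (V i) := by
    refine (LocallyFinite.isClosed_iUnion (hw.closure.subset fun y x hx ↦ hx.1)
      fun y ↦ ?_).isOpen_compl
    exact isClosed_closure.and isClosed_const
  have hFV (i : ι) : F i ⊆ V i := fun x hx hx' ↦ by
    obtain ⟨y, hy⟩ := mem_iUnion.1 hx'
    exact disjoint_left.1 hy.2 hx hy.1
  have hVdisj {i j : ι} {x : Y} (hi : x ∈ V i) (hj : x ∈ V j) : i = j := by
    obtain ⟨y, hy⟩ := iUnion_eq_univ_iff.1 hwU x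
    have key {k : ι} (hk : x ∈ V k) : (F k ∩ closure (w y)).Nonempty := by
      by_contra h
      exact hk (mem_iUnion.2 ⟨y, subset_closure hy,
        disjoint_iff_inter_eq_empty.2 (not_nonempty_iff_eq_empty.1 h)⟩)
    exact hCF y (key hi) (key hj)
  have hFlf : LocallyFinite F := fun x ↦ by
    obtain ⟨N, hN, h⟩ := hF x
    exact ⟨N, hN, h.finite⟩
  obtain ⟨G, hGo, hFG, hGV⟩ := normal_exists_closure_subset (hFlf.isClosed_iUnion hc)
    (isOpen_iUnion hVo) (iUnion_mono hFV)
  refine ⟨fun i ↦ V i ∩ G, fun i ↦ (hVo i).inter hGo,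
    fun i ↦ subset_inter (hFV i) ((subset_iUnion F i).trans hFG), fun x ↦ ?_⟩
  by_cases hx : x ∈ closure G
  · obtain ⟨i, hi⟩ := mem_iUnion.1 (hGV hx)
    refine ⟨V i, (hVo i).mem_nhds hi, ?_⟩
    rintro j ⟨y, hy, hy'⟩ k ⟨z, hz, hz'⟩
    exact (hVdisj hy.1 hy').trans (hVdisj hz' hz.1)
  · refine ⟨(closure G)ᶜ, isClosed_closure.isOpen_compl.mem_nhds hx, ?_⟩
    rintro j ⟨y, hy, hy'⟩
    exact (hy' (subset_closure hy.2)).elim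

/-! ### Infima of pseudometrizable topologies -/

theorem pseudoMetrizableSpace_iInf {Y : Type v} {ι : Type w} [Countable ι]
    {σ : ι → TopologicalSpace Y} (h : ∀ i, @PseudoMetrizableSpace Y (σ i)) :
    @PseudoMetrizableSpace Y (⨅ i, σ i) := by
  choose u hu huc using fun i ↦ (h i).exists_countably_generated
  refine @PseudoMetrizableSpace.mk Y (⨅ i, σ i) ⟨⨅ i, u i, ?_, ?_⟩
  · rw [UniformSpace.toTopologicalSpace_iInf]
    exact iInf_congr hu
  · rw [iInf_uniformity]
    infer_instance

theorem pseudoMetrizableSpace_inf {Y : Type v} {σ σ' : TopologicalSpace Y}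
    (h : @PseudoMetrizableSpace Y σ) (h' : @PseudoMetrizableSpace Y σ') :
    @PseudoMetrizableSpace Y (σ ⊓ σ') := by
  rw [inf_eq_iInf]
  exact pseudoMetrizableSpace_iInf (by rintro (_ | _) <;> assumption)

theorem pseudoMetrizableSpace_induced {X : Type u} {Y : Type v} {σ : TopologicalSpace Y}
    (h : @PseudoMetrizableSpace Y σ) (f : X → Y) : @PseudoMetrizableSpace X (induced f σ) :=
  let _ := induced f σ
  IsInducing.pseudoMetrizableSpace ⟨rfl⟩

theorem metrizableSpace_of_le_of_pseudoMetrizableSpace {Y : Type v} {σ σ' : TopologicalSpace Y}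
    (h : σ ≤ σ') (hσ : @PseudoMetrizableSpace Y σ) (hσ' : @MetrizableSpace Y σ') :
    @MetrizableSpace Y σ := by
  have : @T2Space Y σ := t2Space_antitone h (@t2Space_of_metrizableSpace Y σ' hσ')
  exact @PseudoMetrizableSpace.toMetrizableSpace Y σ _ hσ

theorem Submetrizable.t2Space {X : Type u} [TopologicalSpace X] (hX : Submetrizable X) :
    T2Space X :=
  let ⟨σ, hσ, hm⟩ := hX
  t2Space_antitone hσ (@t2Space_of_metrizableSpace X σ hm)

/-! ### Coarser pseudometrizable topologies on perfect collectionwise normal spaces -/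

/-- For a discrete open expansion of a discrete family of closed sets in a normal space there is
a coarser pseudometrizable topology for which the expanded sets are still neighbourhoods. -/
theorem exists_pseudoMetrizableSpace_of_discreteFamily {Y : Type v} [τ : TopologicalSpace Y]
    [NormalSpace Y] {ι : Type w} {F V : ι → Set Y} (hF : ∀ i, IsClosed (F i))
    (hVo : ∀ i, IsOpen (V i)) (hFV : ∀ i, F i ⊆ V i) (hV : DiscreteFamily V) :
    ∃ σ : TopologicalSpace Y, τ ≤ σ ∧ @PseudoMetrizableSpace Y σ ∧
      ∀ i, ∀ y ∈ F i, V i ∈ @nhds Y σ y := by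
  choose g hg0 hg1 hg using fun i ↦ exists_continuous_zero_one_of_isClosed
    (hVo i).isClosed_compl (hF i) (disjoint_compl_left_iff_subset.2 (hFV i))
  let : TopologicalSpace ι := ⊥
  have : DiscreteTopology ι := ⟨rfl⟩
  -- Near any point at most one coordinate is not identically zero, which makes `φ` continuous for
  -- the sup norm.
  let φ (y : Y) : ι →ᵇ ℝ := BoundedContinuousFunction.ofNormedAddCommGroupDiscrete
    (fun i ↦ g i y) 1 fun i ↦ by
      rw [Real.norm_eq_abs, abs_of_nonneg (hg i y).1]
      exact (hg i y).2
  have hφ : Continuous φ := by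
    refine continuous_iff_continuousAt.2 fun y ↦ Metric.tendsto_nhds.2 fun ε hε ↦ ?_
    obtain ⟨U, hU, hUV⟩ := hV y
    have hzero {i : ι} (hi : ¬ (V i ∩ U).Nonempty) {z : Y} (hz : z ∈ U) : g i z = 0 :=
      hg0 i fun hz' ↦ hi ⟨z, hz', hz⟩
    have hev : ∀ᶠ z in 𝓝 y, ∀ i, (V i ∩ U).Nonempty → dist (g i z) (g i y) < ε / 2 := by
      by_cases h : ∃ i, (V i ∩ U).Nonempty
      · obtain ⟨i, hi⟩ := h
        filter_upwards [Metric.tendsto_nhds.1 ((g i).continuous.tendsto y) _ (half_pos hε)]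
          with z hz j hj
        rwa [hUV hj hi]
      · exact Eventually.of_forall fun z i hi ↦ (h ⟨i, hi⟩).elim
    filter_upwards [hev, hU] with z hz hzU
    refine ((BoundedContinuousFunction.dist_le (half_pos hε).le).2 fun i ↦ ?_).trans_lt
      (half_lt_self hε)
    change dist (g i z) (g i y) ≤ ε / 2
    by_cases hi : (V i ∩ U).Nonempty
    · exact (hz i hi).le
    · rw [hzero hi hzU, hzero hi (mem_of_mem_nhds hU), dist_self]
      exact (half_pos hε).le
  refine ⟨induced φ inferInstance, hφ.le_induced, pseudoMetrizableSpace_induced inferInstance φ, ?_⟩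
  intro i y hy
  rw [nhds_induced]
  refine ⟨Metric.ball (φ y) 1, Metric.ball_mem_nhds _ one_pos, fun z hz ↦ ?_⟩
  by_contra hzV
  have h := (BoundedContinuousFunction.dist_coe_le_dist (f := φ z) (g := φ y) i).trans_lt hz
  change dist (g i z) (g i y) < 1 at h
  rw [hg0 i hzV, hg1 i hy] at h
  simp at h

/-- A locally finite family of closed sets in a perfect collectionwise normal space stays closed
and locally finite for some coarser pseudometrizable topology. -/
theorem LocallyFinite.exists_pseudoMetrizableSpace {Y : Type v} [τ : TopologicalSpace Y]
    (hY : CollectionwiseNormal Y) (hGδ : ClosedSetsGδ Y) {ι : Type w} {D : ι → Set Y}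
    (hD : LocallyFinite D) (hc : ∀ i, IsClosed (D i)) :
    ∃ σ : TopologicalSpace Y, τ ≤ σ ∧ @PseudoMetrizableSpace Y σ ∧
      ∀ y, ∀ᶠ z in @nhds Y σ y, {i | z ∈ D i} ⊆ {i | y ∈ D i} := by
  have := hY.normalSpace
  have hfin := hD.point_finite
  have hev (y : Y) : ∀ᶠ z in 𝓝 y, {i | z ∈ D i} ⊆ {i | y ∈ D i} :=
    hD.eventually_subset hc y
  have hopen (k : ℕ) : IsOpen {y | {i | y ∈ D i}.ncard ≤ k} := by
    refine isOpen_iff_mem_nhds.2 fun y hy ↦ ?_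
    filter_upwards [hev y] with z hz
    exact (ncard_le_ncard hz (hfin y)).trans hy
  have hσ (k : ℕ) : ∃ B : ℕ → Set Y, (∀ m, IsOpen (B m)) ∧
      {y | {i | y ∈ D i}.ncard ≤ k}ᶜ = ⋂ m, B m :=
    isGδ_iff_eq_iInter_nat.1 (hGδ _ (hopen k).isClosed_compl)
  choose B hBo hB using hσ
  have hB' {k m : ℕ} {y : Y} (hy : y ∉ B k m) : {i | y ∈ D i}.ncard ≤ k := by
    by_contra h
    have : y ∈ ⋂ m, B k m := hB k ▸ h
    exact hy (mem_iInter.1 this m)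
  have key (p : ℕ × ℕ) : ∃ σ : TopologicalSpace Y, τ ≤ σ ∧ @PseudoMetrizableSpace Y σ ∧
      ∀ y, {i | y ∈ D i}.ncard = p.1 → y ∉ B p.1 p.2 →
        ∀ᶠ z in @nhds Y σ y, {i | z ∈ D i} ⊆ {i | y ∈ D i} := by
    obtain ⟨k, m⟩ := p
    -- Off `B k m` at most `k` members contain a point, so a `k`-element `J` of such members must be
    -- all of them.
    let F (J : {J : Finset ι // J.card = k}) : Set Y := (⋂ i ∈ J.1, D i) ∩ (B k m)ᶜ
    have hFJ {J : {J : Finset ι // J.card = k}} {y : Y} (hy : y ∈ F J) :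
        (J.1 : Set ι) = {i | y ∈ D i} := by
      refine eq_of_subset_of_ncard_le (fun i hi ↦ mem_iInter₂.1 hy.1 i hi) ?_
        (hfin y)
      rw [ncard_coe_finset, J.2]
      exact hB' hy.2
    have hFc (J) : IsClosed (F J) :=
      (isClosed_biInter fun i _ ↦ hc i).inter (hBo k m).isClosed_compl
    have hFd : DiscreteFamily F := by
      intro x
      by_cases hx : x ∈ B k m
      · refine ⟨B k m, (hBo k m).mem_nhds hx, ?_⟩
        rintro J ⟨y, hy, hy'⟩
        exact (hy.2 hy').elim
      · refine ⟨_, hev x, ?_⟩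
        have hJ {J} (h : (F J ∩ {z | {i | z ∈ D i} ⊆ {i | x ∈ D i}}).Nonempty) :
            (J.1 : Set ι) = {i | x ∈ D i} := by
          obtain ⟨y, hy, hy'⟩ := h
          refine eq_of_subset_of_ncard_le ((hFJ hy).trans_subset hy') ?_ (hfin x)
          rw [ncard_coe_finset, J.2]
          exact hB' hx
        intro J h J' h'
        exact Subtype.ext (Finset.coe_injective ((hJ h).trans (hJ h').symm))
    obtain ⟨V, hVo, hFV, hV⟩ := hY.exists_open_expansion hFc hFd
    have hOo (J : {J : Finset ι // J.card = k}) : IsOpen {z | {i | z ∈ D i} ⊆ (J.1 : Set ι)} := by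
      refine isOpen_iff_mem_nhds.2 fun y hy ↦ ?_
      filter_upwards [hev y] with z hz
      exact hz.trans hy
    -- Intersecting the expansion with these open sets turns being a `σ`-neighbourhood into the
    -- desired inclusion of index sets.
    obtain ⟨σ, hτσ, hσ, hσF⟩ := exists_pseudoMetrizableSpace_of_discreteFamily hFc
      (fun J ↦ (hVo J).inter (hOo J)) (fun J ↦ subset_inter (hFV J) fun y hy ↦ (hFJ hy).superset)
      (hV.mono fun J ↦ inter_subset_left)
    refine ⟨σ, hτσ, hσ, fun y hy hyB ↦ ?_⟩
    have hfin := hfin y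
    let J : {J : Finset ι // J.card = k} :=
      ⟨hfin.toFinset, by rw [← ncard_eq_toFinset_card _ hfin]; exact hy⟩
    have hyJ : y ∈ F J := ⟨mem_iInter₂.2 fun i hi ↦ hfin.mem_toFinset.1 hi, hyB⟩
    exact mem_of_superset (hσF J y hyJ) fun z hz ↦ hz.2.trans (hFJ hyJ).subset
  choose σ hτσ hσ hσD using key
  refine ⟨⨅ p, σ p, le_iInf hτσ, pseudoMetrizableSpace_iInf hσ, fun y ↦ ?_⟩
  have : ∃ m, y ∉ B {i | y ∈ D i}.ncard m := by
    by_contra! h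
    have : y ∈ {z | {i | z ∈ D i}.ncard ≤ {i | y ∈ D i}.ncard}ᶜ := hB _ ▸ mem_iInter.2 h
    exact this (le_refl (α := ℕ) _)
  obtain ⟨m, hm⟩ := this
  exact nhds_mono (iInf_le σ _) (hσD (_, m) y rfl hm)

/-! ### Perfect maps -/

/-- A compact fibre meets finitely many `C i`, and by closedness of `f` nearby fibres meet no
others. -/
theorem IsProperMap.locallyFinite_image {X : Type u} {Y : Type v} [TopologicalSpace X]
    [TopologicalSpace Y] {f : X → Y} (hf : IsProperMap f) {ι : Type w} {C : ι → Set X}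
    (hC : LocallyFinite C) (hc : ∀ i, IsClosed (C i)) : LocallyFinite fun i ↦ f '' C i := by
  intro y
  have hK : IsCompact (f ⁻¹' {y}) := hf.isCompact_preimage isCompact_singleton
  refine ⟨_, hf.isClosedMap.eventually_nhds_fiber (p := fun x ↦
    ∀ i, x ∈ C i → (C i ∩ f ⁻¹' {y}).Nonempty) y fun x hx ↦ ?_,
    (hC.finite_nonempty_inter_compact hK).subset ?_⟩
  · filter_upwards [hC.eventually_subset hc x] with z hz i hi
    exact ⟨x, hz hi, hx⟩
  · rintro i ⟨_, ⟨x, hx, rfl⟩, h⟩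
    exact h x rfl i hx

/-- The fibres of a perfect map depend upper semicontinuously on the point, up to a given `ε`, for
some coarser pseudometrizable topology on the codomain. -/
theorem IsProperMap.exists_pseudoMetrizableSpace_thickening {X : Type u} {Y : Type v} {M : Type w}
    [TopologicalSpace X] [τ : TopologicalSpace Y] [PseudoMetricSpace M]
    (hY : CollectionwiseNormal Y) (hGδ : ClosedSetsGδ Y) {f : X → Y} (hf : IsProperMap f)
    {g : X → M} (hg : Continuous g) {ε : ℝ} (hε : 0 < ε) :
    ∃ σ : TopologicalSpace Y, τ ≤ σ ∧ @PseudoMetrizableSpace Y σ ∧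
      ∀ y, ∀ᶠ z in @nhds Y σ y, ∀ x, f x = z → g x ∈ Metric.thickening ε (g '' (f ⁻¹' {y})) := by
  -- Two points of one `closure (c a)` are at most `2 * ε / 3 < ε` apart.
  obtain ⟨c, -, hcU, hc, hcε⟩ := precise_refinement (fun a : M ↦ Metric.ball a (ε / 3))
    (fun _ ↦ Metric.isOpen_ball)
    (iUnion_eq_univ_iff.2 fun a ↦ ⟨a, Metric.mem_ball_self (by positivity)⟩)
  have hlf : LocallyFinite fun a ↦ g ⁻¹' closure (c a) := hc.closure.preimage_continuous hg
  have hcl (a : M) : IsClosed (g ⁻¹' closure (c a)) := isClosed_closure.preimage hg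
  obtain ⟨σ, hτσ, hσ, hσD⟩ := (hf.locallyFinite_image hlf hcl).exists_pseudoMetrizableSpace
    hY hGδ fun a ↦ hf.isClosedMap _ (hcl a)
  refine ⟨σ, hτσ, hσ, fun y ↦ ?_⟩
  filter_upwards [hσD y] with z hz x hx
  obtain ⟨a, ha⟩ := iUnion_eq_univ_iff.1 hcU (g x)
  obtain ⟨x', hx', hx'y⟩ := hz (show a ∈ {a | z ∈ f '' (g ⁻¹' closure (c a))} from
    ⟨x, subset_closure ha, hx⟩)
  have hdist {b : M} (hb : b ∈ closure (c a)) : dist b a ≤ ε / 3 :=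
    closure_minimal ((hcε a).trans Metric.ball_subset_closedBall) Metric.isClosed_closedBall hb
  refine Metric.mem_thickening_iff.2 ⟨g x', ⟨x', hx'y, rfl⟩, ?_⟩
  have h₁ := dist_triangle_right (g x) (g x') a
  have h₂ := hdist (subset_closure ha)
  have h₃ := hdist hx'
  linarith

/-- A filter-theoretic form of compactness in a pseudometric space. -/
theorem IsCompact.exists_ultrafilter_le_nhds_of_thickening {M : Type w} [PseudoMetricSpace M]
    {K : Set M} (hK : IsCompact K) {𝒰 : Ultrafilter M}
    (h : ∀ n : ℕ, Metric.thickening (1 / ((n : ℝ) + 1)) K ∈ 𝒰) : ∃ x ∈ K, (𝒰 : Filter M) ≤ 𝓝 x := by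
  by_contra! hne
  have hU (x : M) (hx : x ∈ K) : ∃ U, IsOpen U ∧ x ∈ U ∧ U ∉ 𝒰 := by
    obtain ⟨s, hs, hs'⟩ := Filter.not_le.1 (hne x hx)
    obtain ⟨U, hUs, hUo, hxU⟩ := mem_nhds_iff.1 hs
    exact ⟨U, hUo, hxU, fun hU ↦ hs' (mem_of_superset hU hUs)⟩
  choose! U hUo hxU hU𝒰 using hU
  obtain ⟨t, htK, hKt⟩ := hK.elim_nhds_subcover U fun x hx ↦ (hUo x hx).mem_nhds (hxU x hx)
  obtain ⟨δ, hδ, hδt⟩ := hK.exists_thickening_subset_open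
    (isOpen_biUnion fun x hx ↦ hUo x (htK x hx)) hKt
  obtain ⟨n, hn⟩ := exists_nat_one_div_lt hδ
  obtain ⟨x, hx, hx𝒰⟩ := (Ultrafilter.finite_biUnion_mem_iff t.finite_toSet).1
    (mem_of_superset (h n) ((Metric.thickening_mono hn.le K).trans hδt))
  exact hU𝒰 x (htK x hx) hx𝒰

theorem IsProperMap.perfectSubmetrizable {X : Type u} {Y : Type v} [τX : TopologicalSpace X]
    [τY : TopologicalSpace Y] (hX : Submetrizable X) (hY : Submetrizable Y)
    (hcn : CollectionwiseNormal Y) (hGδ : ClosedSetsGδ Y) {f : X → Y} (hf : IsProperMap f) :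
    PerfectSubmetrizable f := by
  have hfc := hf.continuous
  have hfK (y : Y) : IsCompact (f ⁻¹' {y}) := hf.isCompact_preimage isCompact_singleton
  obtain ⟨ρX, hτρX, hρX⟩ := hX
  obtain ⟨ρY, hτρY, hρY⟩ := hY
  obtain ⟨m, rfl⟩ : ∃ m : PseudoMetricSpace X, m.toUniformSpace.toTopologicalSpace = ρX :=
    ⟨@pseudoMetrizableSpacePseudoMetric X ρX hρX.toPseudoMetrizableSpace, rfl⟩
  have hσ (n : ℕ) := @IsProperMap.exists_pseudoMetrizableSpace_thickening X Y X τX τY m hcn hGδ f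
    hf id (continuous_id_iff_le.2 hτρX) (1 / ((n : ℝ) + 1)) Nat.one_div_pos_of_nat
  choose σ hτσ hσm hσ using hσ
  let σY : TopologicalSpace Y := ρY ⊓ ⨅ n, σ n
  let σX : TopologicalSpace X := m.toUniformSpace.toTopologicalSpace ⊓ induced f σY
  have hτY : τY ≤ σY := le_inf hτρY (le_iInf hτσ)
  have hτX : τX ≤ σX :=
    le_inf hτρX (continuous_iff_le_induced.1 (continuous_le_rng hτY hfc))
  have hσYm : @PseudoMetrizableSpace Y σY :=
    pseudoMetrizableSpace_inf hρY.toPseudoMetrizableSpace (pseudoMetrizableSpace_iInf hσm)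
  have hσXm : @PseudoMetrizableSpace X σX := pseudoMetrizableSpace_inf
    hρX.toPseudoMetrizableSpace
    (pseudoMetrizableSpace_induced hσYm f)
  have hσ' (n : ℕ) (y : Y) : {z | ∀ x, f x = z → x ∈ @Metric.thickening X m.toPseudoEMetricSpace
      (1 / ((n : ℝ) + 1)) (f ⁻¹' {y})} ∈ @nhds Y σY y := by
    have := nhds_mono (show σY ≤ σ n from inf_le_right.trans (iInf_le σ n)) (hσ n y)
    simpa only [image_id', id_eq] using this
  refine ⟨σX, ⟨hτX, metrizableSpace_of_le_of_pseudoMetrizableSpace inf_le_left hσXm hρX⟩,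
    σY, ⟨hτY, metrizableSpace_of_le_of_pseudoMetrizableSpace inf_le_left hσYm hρY⟩, ?_⟩
  refine (@isProperMap_iff_ultrafilter X Y σX σY f).2
    ⟨(@continuous_iff_le_induced X Y f σX σY).2 inf_le_right, fun 𝒰 y hy ↦ ?_⟩
  have hK : @IsCompact X m.toUniformSpace.toTopologicalSpace (f ⁻¹' {y}) := by
    have := @IsCompact.image X X τX m.toUniformSpace.toTopologicalSpace _ id
      (hfK y) (continuous_id_iff_le.2 hτρX)
    rwa [image_id] at this
  obtain ⟨x, hxy, hx⟩ := hK.exists_ultrafilter_le_nhds_of_thickening (𝒰 := 𝒰) fun n ↦ by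
    filter_upwards [hy (hσ' n y)] with x hx using hx x rfl
  refine ⟨x, hxy, ?_⟩
  -- Convergence in `σX` splits into convergence for the metric, given by `hx`, and convergence of
  -- the image in `σY`, given by `hy`.
  refine (le_inf hx ?_).trans (@nhds_inf X m.toUniformSpace.toTopologicalSpace (induced f σY) x).ge
  rw [@nhds_induced Y X σY f x, ← map_le_iff_le_comap, show f x = y from hxy]
  exact hy

/-- A perfect map `f : X → Y` of submetrizable spaces remains perfect for suitable weaker
metrizable topologies if `Y` is collectionwise normal and its closed sets are `Gδ`; in particular
this holds if `X` and `Y` are paracompact and `Y` is perfectly normal. -/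
theorem mainTheorem1 {X : Type u} {Y : Type v} [TopologicalSpace X] [TopologicalSpace Y]
    (hX : Submetrizable X) (hY : Submetrizable Y) (f : X → Y) (hf : IsProperMap f) :
    (CollectionwiseNormal Y → ClosedSetsGδ Y → PerfectSubmetrizable f) ∧
    (ParacompactSpace X → ParacompactSpace Y → PerfectlyNormalSpace Y →
      PerfectSubmetrizable f) := by
  refine ⟨hf.perfectSubmetrizable hX hY, fun _ _ hYp ↦ ?_⟩
  have := hY.t2Space
  exact hf.perfectSubmetrizable hX hY (CollectionwiseNormal.of_paracompactSpace Y)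
    fun s hs ↦ hYp.closed_gdelta hs
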